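/- For $d\in\mathbb N$ let $X\subset\{0,\dots,d-1\}^{\mathbb Z}$ be a nonempty subshift (a nonempty closed set that is invariant under the left shift $f$ and its inverse). Let $\mathcal L(X,n)$ be the set of words of length $n$ that occur in points of $X$, and for a word $\tau$ of length $n$ let $[\tau]=\{x\in X: x_0\cdots x_{n-1}=\tau\}$. For $\varphi\in C(X,\mathbb R)$ and $n\ge 1$ put $$Z_n(\varphi)=\sum_{\tau\in\mathcal L(X,n)}\exp\Big(\sup_{x\in[\tau]}\sum_{k=0}^{n-1}\varphi(f^k(x))\Big),\qquad P_{\rm top}(X,\varphi)=\lim_{n\to\infty}\frac1n\log Z_n(\varphi).$$ An oracle for (the language of) $X$ is a function $\psi$ such that, for every $n\in\mathbb N$, $\psi(n)$ is a finite list of exactly the words in $\mathcal L(X,2n+1)$. Given such a $\psi$, an oracle for $\varphi\in C(X,\mathbb R)$ is a function $\chi$ such that, for every $n\in\mathbb N$, $\chi(n)=(k,q)$ represents a rational-valued locally constant potential $g$ with $\|g-\varphi\|_\infty<2^{-n}$; here $k\in\mathbb N$, $q$ is a list of rational numbers with one entry for each entry of the list $\psi(k)$, and $g(x)$ is the entry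 of $q$ at the position of the word $x_{-k}\cdots x_k$ in $\psi(k)$. (i) The pressure $P_{\rm top}(X,\cdot)$ is upper semi-computable on $C(X,\mathbb R)$ whenever $X$ is given by an oracle: there is one oracle Turing machine $M$ such that for every $d$, every nonempty subshift $X\subset\{0,\dots,d-1\}^{\mathbb Z}$, every oracle $\psi$ for $X$, every $\varphi\in C(X,\mathbb R)$ and every oracle $\chi$ for $\varphi$, the machine $M$ with access to $\psi$ and $\chi$ halts on every input $n\in\mathbb N$ and outputs a rational number $u_n$, such that $(u_n)_{n\in\mathbb N}$ is nonincreasing and converges to $P_{\rm top}(X,\varphi)$. (ii) For every nonempty subshift $X\subset\{0,\dots,d-1\}^{\mathbb Z}$ and every $\varphi\in C(X,\mathbb R)$, the limit defining $P_{\rm top}(X,\varphi)$ exists in $\mathbb R$, and $P_{\rm top}(X,\varphi)=\inf\{\frac1n\log Z_n(\varphi): n\ge1\}$. -/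

import Mathlib

open Filter Topology
open SymbolicDynamics.FullShift (Subshift)

namespace SubshiftPressure

/-! ### Oracle machines

An oracle machine is a program for a partial recursive function which may in addition query
finitely many oracles. Programs are finite objects that do not depend on the oracles; this is what
makes it possible to speak of one machine that works for all oracles. -/

/-- Programs of oracle machines with oracles indexed by `ι`: the constructors are those of
`Nat.RecursiveIn`, as syntax. -/
inductive OracleCode (ι : Type) : Type
  | zero : OracleCode ι
  | succ : OracleCode ι
  | left : OracleCode ι
  | right : OracleCode ι
  | oracle (i : ι) : OracleCode ι
  | pair (cf ch : OracleCode ι) : OracleCode ι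
  | comp (cf ch : OracleCode ι) : OracleCode ι
  | prec (cf ch : OracleCode ι) : OracleCode ι
  | rfind (cf : OracleCode ι) : OracleCode ι

/-- The partial function computed by a program when it is run with the oracles `O i : ℕ → ℕ`. -/
def OracleCode.eval {ι : Type} (O : ι → ℕ → ℕ) : OracleCode ι → ℕ →. ℕ
  | .zero => fun _ => Part.some 0
  | .succ => fun n => Part.some (n + 1)
  | .left => fun n => Part.some n.unpair.1
  | .right => fun n => Part.some n.unpair.2
  | .oracle i => fun n => Part.some (O i n)
  | .pair cf ch => fun n => Nat.pair <$> cf.eval O n <*> ch.eval O n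
  | .comp cf ch => fun n => ch.eval O n >>= cf.eval O
  | .prec cf ch => fun p =>
      Nat.rec (motive := fun _ => Part ℕ) (cf.eval O p.unpair.1)
        (fun y IH => do
          let i ← IH
          ch.eval O (Nat.pair p.unpair.1 (Nat.pair y i)))
        p.unpair.2
  | .rfind cf => fun a =>
      Nat.rfind fun n => (fun m => decide (m = 0)) <$> cf.eval O (Nat.pair a n)

/-- Finite codes for rational numbers: `(a, b, c)` stands for `(a - b) / (c + 1)`. -/
abbrev RatCode : Type := ℕ × ℕ × ℕ

/-- The rational number denoted by a code. -/
def RatCode.val (r : RatCode) : ℚ := ((r.1 : ℚ) - (r.2.1 : ℚ)) / ((r.2.2 : ℚ) + 1)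

/-- Run with the oracles `O`, the machine `M` halts on every input `n` and outputs (a code for) a
rational number, and these rational numbers form a nonincreasing sequence that converges to `y`. -/
def OracleCode.ApproximatesFromAbove {ι : Type} (M : OracleCode ι) (O : ι → ℕ → ℕ) (y : ℝ) :
    Prop :=
  ∃ u : ℕ → RatCode, (∀ n, Encodable.encode (u n) ∈ M.eval O n) ∧
    Antitone (fun n => (u n).val) ∧
    Tendsto (fun n => ((u n).val : ℝ)) atTop (𝓝 y)

/-! ### Subshifts over the alphabet `{0, …, d - 1}`, words, pressure -/

variable {d : ℕ}

instance (X : Subshift (Fin d) ℤ) : CompactSpace X.carrier :=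
  isCompact_iff_compactSpace.1 X.isClosed.isCompact

/-- The substring `x i, x (i + 1), …, x (i + n - 1)` of length `n` of the sequence `x`. -/
def substring (x : ℤ → Fin d) (i : ℤ) (n : ℕ) : Fin n → Fin d := fun j => x (i + (j : ℤ))

/-- The set of admissible words of length `n`: the substrings of length `n` of points of `X`. -/
def language (X : Subshift (Fin d) ℤ) (n : ℕ) : Set (Fin n → Fin d) :=
  {τ | ∃ x ∈ X.carrier, ∃ i : ℤ, substring x i n = τ}

/-- The cylinder generated by the word `τ` starting at `0`. -/
def cylinder (X : Subshift (Fin d) ℤ) {n : ℕ} (τ : Fin n → Fin d) : Set X.carrier :=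
  {x | substring x.1 0 n = τ}

/-- The left shift map of the subshift `X`. -/
def shiftMap (X : Subshift (Fin d) ℤ) : X.carrier → X.carrier :=
  (X.mapsTo 1).restrict _ _ _

/-- The `n`-th partition function
`Z_n(φ) = ∑_{τ ∈ L(X, n)} exp (sup_{x ∈ [τ]} S_n φ(x))`. -/
noncomputable def partitionFunction (X : Subshift (Fin d) ℤ) (φ : C(X.carrier, ℝ)) (n : ℕ) : ℝ :=
  ∑ τ ∈ (Set.toFinite (language X n)).toFinset,
    Real.exp (sSup (birkhoffSum (shiftMap X) φ n '' cylinder X τ))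

/-- The topological pressure `P_top(X, φ) = lim (1/n) log Z_n(φ)`. -/
noncomputable def pressure (X : Subshift (Fin d) ℤ) (φ : C(X.carrier, ℝ)) : ℝ :=
  limUnder atTop fun n : ℕ => 1 / (n : ℝ) * Real.log (partitionFunction X φ n)

/-! ### Oracles for subshifts and for potentials -/

/-- A word over `{0, …, d - 1}` as a list of natural numbers. -/
def wordList {n : ℕ} (τ : Fin n → Fin d) : List ℕ := List.ofFn fun j => (τ j : ℕ)

/-- `ψ` is an oracle for (the language of) `X`: on input `n`, it lists (in some order) all
admissible words of `X` of length `2n + 1`, and only those. -/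
def IsLanguageOracle (X : Subshift (Fin d) ℤ) (ψ : ℕ → List (List ℕ)) : Prop :=
  ∀ n, ∀ w : List ℕ, w ∈ ψ n ↔ ∃ τ ∈ language X (2 * n + 1), wordList τ = w

/-- The pair `(k, q)` represents the rational-valued locally constant potential `g`, relative to
the listing `ψ k` of the admissible words of length `2k + 1`: the list `q` has one entry for each
entry of `ψ k`, and `g x` is the entry that belongs to the word `x[-k, k]`. -/
def Represents (X : Subshift (Fin d) ℤ) (ψ : ℕ → List (List ℕ)) (k : ℕ) (q : List RatCode)
    (g : C(X.carrier, ℝ)) : Prop :=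
  q.length = (ψ k).length ∧
    ∀ x : X.carrier, ∀ p ∈ (ψ k).zip q,
      p.1 = wordList (substring x.1 (-(k : ℤ)) (2 * k + 1)) → g x = (p.2.val : ℝ)

/-- `χ` is an oracle for the potential `φ`: on input `n`, it gives a (representation of a)
rational-valued locally constant potential at supremum distance less than `2⁻ⁿ` from `φ`. -/
def IsPotentialOracle (X : Subshift (Fin d) ℤ) (ψ : ℕ → List (List ℕ)) (φ : C(X.carrier, ℝ))
    (χ : ℕ → ℕ × List RatCode) : Prop :=
  ∀ n, ∃ g : C(X.carrier, ℝ), Represents X ψ (χ n).1 (χ n).2 g ∧ ‖g - φ‖ < (2 : ℝ)⁻¹ ^ n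

/-- The two oracles `ψ` (number `0`) and `χ` (number `1`) as functions on natural numbers, by the
standard encoding of lists and pairs. -/
def oracles (ψ : ℕ → List (List ℕ)) (χ : ℕ → ℕ × List RatCode) : Fin 2 → ℕ → ℕ :=
  ![fun n => Encodable.encode (ψ n), fun n => Encodable.encode (χ n)]

/-- The machine `M` witnesses that `F : C(X, ℝ) → ℝ` is upper semi-computable, where `X` is given
by the oracle `ψ`: for every potential `φ` and every oracle `χ` for `φ`, the outputs of `M` with
access to `ψ` and `χ` are a nonincreasing sequence of rational numbers with limit `F φ`. -/
def UpperSemicomputes (M : OracleCode (Fin 2)) (X : Subshift (Fin d) ℤ) (ψ : ℕ → List (List ℕ))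
    (F : C(X.carrier, ℝ) → ℝ) : Prop :=
  ∀ (φ : C(X.carrier, ℝ)) (χ : ℕ → ℕ × List RatCode), IsPotentialOracle X ψ φ χ →
    M.ApproximatesFromAbove (oracles ψ χ) (F φ)

end SubshiftPressure

/-! Cutting a word of length `m + n` after `m` letters is injective into pairs of admissible words,
and Birkhoff sums split accordingly. Hence `Z_{m+n} ≤ Z_m * Z_n` (`partitionFunction_add_le`). Since
`Z_n ≥ exp (-n‖φ‖)`, Fekete's lemma shows that the limit exists and is the infimum, which is (ii).

For (i), the infimum formula turns any upper bound for a single `(1/N) log Z_N` into an upper bound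
for the pressure. Such bounds can be certified in exact arithmetic. A candidate is a tuple `(n, C,
m, p)` with `N = 2m + 1`, a length that the language oracle lists. From `χ n = (k, q)` each word of
length `N` gets a natural weight that dominates `(n + 2) * (S_N φ + N C)` on its cylinder. Powers of
`(n + 2) / (n + 1)` replace exponentials because `1/(n+2) ≤ log ((n+2)/(n+1)) ≤ 1/(n+1)`, so testing
a candidate is an inequality between natural numbers.

Every certificate is sound (`pressure_le_certifiedBound`). Conversely (`exists_certificate`), for `C
≥ ‖φ‖ + 1` some certified bound exceeds `(1/N) log Z_N` only by errors that vanish as first `m` and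
then `n` tends to infinity (`exists_candidateBound_lt`). The machine finds a first certificate by
unbounded search and then outputs running minima over the enumerated candidates. -/

namespace SubshiftPressure

/-! ### Cylinders and Birkhoff sums -/

section Pressure

variable {d : ℕ} {X : Subshift (Fin d) ℤ}

/-- The point of `X` obtained from `x` by shifting `i` places to the left. -/
def translate (i : ℤ) (x : X.carrier) : X.carrier := ⟨_, X.mapsTo i x.2⟩

@[simp] theorem translate_apply (i : ℤ) (x : X.carrier) (j : ℤ) :
    (translate i x).1 j = x.1 (i + j) := rfl

theorem shiftMap_iterate_apply (n : ℕ) (x : X.carrier) (j : ℤ) :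
    ((shiftMap X)^[n] x).1 j = x.1 (n + j) := by
  induction n generalizing x with
  | zero => simp
  | succ n ih =>
    rw [Function.iterate_succ_apply, ih]
    change x.1 (1 + (n + j)) = _
    exact congrArg x.1 (by push_cast; ring)

theorem substring_mem_language (x : X.carrier) (i : ℤ) (n : ℕ) :
    substring x.1 i n ∈ language X n := ⟨x.1, x.2, i, rfl⟩

theorem substring_translate (x : X.carrier) (i j : ℤ) (n : ℕ) :
    substring (translate i x).1 j n = substring x.1 (i + j) n := by
  ext l
  simp [substring, add_assoc]

theorem substring_shiftMap_iterate (x : X.carrier) (m : ℕ) (j : ℤ) (n : ℕ) :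
    substring ((shiftMap X)^[m] x).1 j n = substring x.1 (m + j) n := by
  ext l
  simp [substring, shiftMap_iterate_apply, add_assoc]

/-- Invariance under all translations moves an occurrence at any place to position `0`. This ensures
that no supremum in the partition function is taken over the empty set. -/
theorem cylinder_nonempty {n : ℕ} {τ : Fin n → Fin d} (h : τ ∈ language X n) :
    (cylinder X τ).Nonempty := by
  obtain ⟨x, hx, i, rfl⟩ := h
  refine ⟨translate i ⟨x, hx⟩, ?_⟩
  change substring (translate i ⟨x, hx⟩).1 0 n = _
  rw [substring_translate]
  simp

theorem language_nonempty (hX : X.carrier.Nonempty) (n : ℕ) : (language X n).Nonempty :=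
  ⟨_, substring_mem_language ⟨_, hX.some_mem⟩ 0 n⟩

variable (φ : C(X.carrier, ℝ))

theorem abs_birkhoffSum_le (n : ℕ) (x : X.carrier) :
    |birkhoffSum (shiftMap X) φ n x| ≤ n * ‖φ‖ := by
  refine (Finset.abs_sum_le_sum_abs _ _).trans ?_
  refine (Finset.sum_le_card_nsmul _ _ ‖φ‖ fun i _ => φ.norm_coe_le_norm _).trans ?_
  simp

theorem bddAbove_birkhoffSum_image (n : ℕ) (s : Set X.carrier) :
    BddAbove (birkhoffSum (shiftMap X) φ n '' s) := by
  refine ⟨n * ‖φ‖, ?_⟩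
  rintro _ ⟨x, -, rfl⟩
  exact (abs_le.1 (abs_birkhoffSum_le φ n x)).2

theorem partitionFunction_le_sum_exp {n : ℕ} (F : (Fin n → Fin d) → ℝ)
    (hF : ∀ x : X.carrier, birkhoffSum (shiftMap X) φ n x ≤ F (substring x.1 0 n)) :
    partitionFunction X φ n ≤ ∑ τ ∈ (Set.toFinite (language X n)).toFinset, Real.exp (F τ) := by
  refine Finset.sum_le_sum fun τ hτ => Real.exp_le_exp.2 (csSup_le ?_ ?_)
  · exact (cylinder_nonempty ((Set.Finite.mem_toFinset _).1 hτ)).image _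
  · rintro _ ⟨x, hx, rfl⟩
    have := hF x
    rwa [show substring x.1 0 n = τ from hx] at this

theorem sum_exp_le_partitionFunction {n : ℕ} (F : (Fin n → Fin d) → ℝ)
    (hF : ∀ x : X.carrier, F (substring x.1 0 n) ≤ birkhoffSum (shiftMap X) φ n x) :
    ∑ τ ∈ (Set.toFinite (language X n)).toFinset, Real.exp (F τ) ≤ partitionFunction X φ n := by
  refine Finset.sum_le_sum fun τ hτ => Real.exp_le_exp.2 ?_
  obtain ⟨x, hx⟩ := cylinder_nonempty ((Set.Finite.mem_toFinset _).1 hτ)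
  have := hF x
  rw [show substring x.1 0 n = τ from hx] at this
  exact this.trans (le_csSup (bddAbove_birkhoffSum_image φ n _) ⟨x, hx, rfl⟩)

theorem exp_neg_le_partitionFunction (hX : X.carrier.Nonempty) (n : ℕ) :
    Real.exp (-(n * ‖φ‖)) ≤ partitionFunction X φ n := by
  refine le_trans ?_ (sum_exp_le_partitionFunction φ (fun _ => -(n * ‖φ‖)) fun x =>
    (abs_le.1 (abs_birkhoffSum_le φ n x)).1)
  obtain ⟨τ, hτ⟩ := language_nonempty hX n
  exact Finset.single_le_sum (f := fun _ : Fin n → Fin d => Real.exp (-(n * ‖φ‖)))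
    (fun _ _ => (Real.exp_pos _).le)
    ((Set.Finite.mem_toFinset (Set.toFinite (language X n))).2 hτ)

theorem partitionFunction_pos (hX : X.carrier.Nonempty) (n : ℕ) :
    0 < partitionFunction X φ n :=
  (Real.exp_pos _).trans_le (exp_neg_le_partitionFunction φ hX n)

/-! ### Submultiplicativity of the partition function and Fekete's lemma -/

theorem partitionFunction_add_le (m n : ℕ) :
    partitionFunction X φ (m + n) ≤ partitionFunction X φ m * partitionFunction X φ n := by
  set s : ∀ l : ℕ, (Fin l → Fin d) → ℝ :=
    fun l τ => sSup (birkhoffSum (shiftMap X) φ l '' cylinder X τ) with hs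
  let r : (Fin (m + n) → Fin d) → (Fin m → Fin d) × (Fin n → Fin d) :=
    fun τ => (fun i => τ (Fin.castAdd n i), fun i => τ (Fin.natAdd m i))
  have hr (x : X.carrier) : r (substring x.1 0 (m + n)) =
      (substring x.1 0 m, substring ((shiftMap X)^[m] x).1 0 n) := by
    rw [substring_shiftMap_iterate]
    refine Prod.ext ?_ ?_ <;> ext i <;> simp [r, substring]
  have hle (l : ℕ) (x : X.carrier) :
      birkhoffSum (shiftMap X) φ l x ≤ s l (substring x.1 0 l) :=
    le_csSup (bddAbove_birkhoffSum_image φ l _) ⟨x, rfl, rfl⟩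
  refine (partitionFunction_le_sum_exp φ (fun τ => s m (r τ).1 + s n (r τ).2) fun x => ?_).trans ?_
  · rw [birkhoffSum_add, hr]
    exact add_le_add (hle m x) (hle n _)
  · unfold partitionFunction
    rw [Finset.sum_mul_sum, ← Finset.sum_product']
    simp only [← Real.exp_add]
    have hinj : Function.Injective r := fun τ τ' h => by
      ext i
      refine Fin.addCases (fun i => ?_) (fun i => ?_) i
      · exact congrArg Fin.val (congrFun (congrArg Prod.fst h) i)
      · exact congrArg Fin.val (congrFun (congrArg Prod.snd h) i)
    -- Only an inclusion of index sets is left: a pair of admissible words need not concatenate to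
    -- an admissible word, and the additional terms are positive.
    rw [← Finset.sum_image (f := fun p => Real.exp (s m p.1 + s n p.2)) hinj.injOn]
    refine Finset.sum_le_sum_of_subset_of_nonneg ?_ fun _ _ _ => (Real.exp_pos _).le
    intro p hp
    obtain ⟨τ, hτ, rfl⟩ := Finset.mem_image.1 hp
    obtain ⟨x, hx⟩ := cylinder_nonempty ((Set.Finite.mem_toFinset _).1 hτ)
    obtain rfl : substring x.1 0 (m + n) = τ := hx
    rw [hr]
    simp [substring_mem_language]

theorem subadditive_log_partitionFunction (hX : X.carrier.Nonempty) :
    Subadditive fun n => Real.log (partitionFunction X φ n) := fun m n => by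
  rw [← Real.log_mul (partitionFunction_pos φ hX m).ne' (partitionFunction_pos φ hX n).ne']
  exact Real.log_le_log (partitionFunction_pos φ hX _) (partitionFunction_add_le φ m n)

theorem bddBelow_log_partitionFunction_div (hX : X.carrier.Nonempty) :
    BddBelow (Set.range fun n : ℕ => Real.log (partitionFunction X φ n) / n) := by
  refine ⟨-‖φ‖, ?_⟩
  rintro _ ⟨n, rfl⟩
  -- The range includes `n = 0`, where division by zero gives `0 ≥ -‖φ‖`.
  rcases n.eq_zero_or_pos with rfl | hn
  · simp
  · have hn' : (0 : ℝ) < n := by exact_mod_cast hn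
    rw [le_div_iff₀ hn', Real.le_log_iff_exp_le (partitionFunction_pos φ hX n)]
    convert exp_neg_le_partitionFunction φ hX n using 2
    ring

theorem tendsto_log_partitionFunction (hX : X.carrier.Nonempty) :
    Tendsto (fun n : ℕ => 1 / (n : ℝ) * Real.log (partitionFunction X φ n)) atTop
      (𝓝 (pressure X φ)) := by
  refine tendsto_nhds_limUnder ⟨(subadditive_log_partitionFunction φ hX).lim, ?_⟩
  simpa only [one_div_mul_eq_div] using (subadditive_log_partitionFunction φ hX).tendsto_lim
    (bddBelow_log_partitionFunction_div φ hX)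

theorem pressure_le (hX : X.carrier.Nonempty) {n : ℕ} (hn : 1 ≤ n) :
    pressure X φ ≤ 1 / (n : ℝ) * Real.log (partitionFunction X φ n) := by
  have h := (subadditive_log_partitionFunction φ hX).tendsto_lim
    (bddBelow_log_partitionFunction_div φ hX)
  have h' := tendsto_log_partitionFunction φ hX
  simp only [one_div_mul_eq_div] at h' ⊢
  rw [tendsto_nhds_unique h' h]
  exact (subadditive_log_partitionFunction φ hX).lim_le_div
    (bddBelow_log_partitionFunction_div φ hX) (by omega)

theorem isGLB_pressure (hX : X.carrier.Nonempty) :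
    IsGLB {r : ℝ | ∃ n : ℕ, 1 ≤ n ∧ r = 1 / (n : ℝ) * Real.log (partitionFunction X φ n)}
      (pressure X φ) := by
  refine ⟨?_, fun b hb => ?_⟩
  · rintro _ ⟨n, hn, rfl⟩
    exact pressure_le φ hX hn
  · refine ge_of_tendsto (tendsto_log_partitionFunction φ hX) ?_
    filter_upwards [eventually_ge_atTop 1] with n hn
    exact hb ⟨n, hn, rfl⟩

end Pressure

/-! ### Functions computed by oracle machines -/

section OracleComputable

open Encodable

variable {ι Ω α β γ : Type} [Primcodable α] [Primcodable β] [Primcodable γ]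

/-- The family of functions `F ω : α → β` is computed by one program, which for the parameter `ω`
is run with the oracles `O ω`. -/
def OracleComputable (O : Ω → ι → ℕ → ℕ) (F : Ω → α → β) : Prop :=
  ∃ c : OracleCode ι, ∀ ω a, encode (F ω a) ∈ c.eval (O ω) (encode a)

/-- The constructors of `Nat.Primrec` are among those of `OracleCode`, so one program without
queries works for every oracle. -/
theorem exists_oracleCode_of_natPrimrec {f : ℕ → ℕ} (hf : Nat.Primrec f) :
    ∃ c : OracleCode ι, ∀ O n, c.eval O n = Part.some (f n) := by
  induction hf with
  | zero => exact ⟨.zero, fun _ _ => rfl⟩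
  | succ => exact ⟨.succ, fun _ _ => rfl⟩
  | left => exact ⟨.left, fun _ _ => rfl⟩
  | right => exact ⟨.right, fun _ _ => rfl⟩
  | pair _ _ hf hg =>
    obtain ⟨c, hc⟩ := hf
    obtain ⟨e, he⟩ := hg
    exact ⟨.pair c e, fun O n => by simp [OracleCode.eval, hc, he, Seq.seq]⟩
  | comp _ _ hf hg =>
    obtain ⟨c, hc⟩ := hf
    obtain ⟨e, he⟩ := hg
    exact ⟨.comp c e, fun O n => by
      simp only [OracleCode.eval, he]
      exact (Part.bind_some _ _).trans (hc O _)⟩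
  | prec _ _ hf hg =>
    obtain ⟨c, hc⟩ := hf
    obtain ⟨e, he⟩ := hg
    refine ⟨.prec c e, fun O n => ?_⟩
    simp only [OracleCode.eval, hc, he, Nat.unpaired]
    induction n.unpair.2 with
    | zero => rfl
    | succ y ih => exact (congrArg (Part.bind · _) ih).trans (Part.bind_some _ _)

variable {O : Ω → ι → ℕ → ℕ}

theorem OracleComputable.of_primrec {f : α → β} (hf : Primrec f) :
    OracleComputable O fun _ => f := by
  -- `Primrec f` concerns `encode` of an option, which is the successor of the code of the value;
  -- the predecessor removes this shift.
  obtain ⟨c, hc⟩ := exists_oracleCode_of_natPrimrec (ι := ι)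
    (Primrec.nat_iff.1 (Primrec.pred.comp (Primrec.nat_iff.2 hf)))
  exact ⟨c, fun ω a => by simp [hc]⟩

theorem OracleComputable.comp {F : Ω → β → γ} {G : Ω → α → β} (hF : OracleComputable O F)
    (hG : OracleComputable O G) : OracleComputable O fun ω a => F ω (G ω a) := by
  obtain ⟨c, hc⟩ := hF
  obtain ⟨e, he⟩ := hG
  exact ⟨.comp c e, fun ω a => Part.mem_bind (he ω a) (hc ω _)⟩

theorem OracleComputable.pair {F : Ω → α → β} {G : Ω → α → γ} (hF : OracleComputable O F)
    (hG : OracleComputable O G) : OracleComputable O fun ω a => (F ω a, G ω a) := by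
  obtain ⟨c, hc⟩ := hF
  obtain ⟨e, he⟩ := hG
  refine ⟨.pair c e, fun ω a => ?_⟩
  simp only [OracleCode.eval, Part.eq_some_iff.2 (hc ω a), Part.eq_some_iff.2 (he ω a)]
  simp [Seq.seq]

theorem OracleComputable.query (i : ι) {G : Ω → ℕ → β} (hG : ∀ ω n, O ω i n = encode (G ω n)) :
    OracleComputable O G :=
  ⟨.oracle i, fun ω n => by simp [OracleCode.eval, hG]⟩

theorem OracleComputable.nat_rec {F : Ω → α → β} {G : Ω → α × ℕ × β → β}
    (hF : OracleComputable O F) (hG : OracleComputable O G) :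
    OracleComputable O fun ω (p : α × ℕ) =>
      Nat.rec (motive := fun _ => β) (F ω p.1) (fun y b => G ω (p.1, y, b)) p.2 := by
  obtain ⟨c, hc⟩ := hF
  obtain ⟨e, he⟩ := hG
  refine ⟨.prec c e, fun ω p => ?_⟩
  obtain ⟨a, n⟩ := p
  simp only [OracleCode.eval, encode_prod_val, Nat.unpair_pair, encode_nat]
  induction n with
  | zero => exact hc ω a
  | succ n ih => exact Part.mem_bind ih (he ω (a, n, _))

theorem OracleComputable.find {P : Ω → ℕ → Bool} (hP : OracleComputable O P)
    (h : ∀ ω, ∃ n, P ω n = true) :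
    OracleComputable O fun ω (_ : α) => Nat.find (h ω) := by
  -- `rfind` looks for a zero, so `true` is sent to `0`.
  obtain ⟨c, hc⟩ := (OracleComputable.of_primrec
    (Primrec.dom_bool fun b : Bool => cond b 0 1)).comp hP |>.comp
      (OracleComputable.of_primrec (Primrec.snd (α := α) (β := ℕ)))
  refine ⟨.rfind c, fun ω a => ?_⟩
  have hc' (n : ℕ) : c.eval (O ω) (Nat.pair (encode a) n) = Part.some (cond (P ω n) 0 1) :=
    Part.eq_some_iff.2 (hc ω (a, n))
  simp only [OracleCode.eval, encode_nat, hc']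
  refine Nat.mem_rfind.2 ⟨?_, fun {m} hm => ?_⟩
  · simp [Nat.find_spec (h ω)]
  · simp [Bool.eq_false_of_not_eq_true (Nat.find_min (h ω) hm)]

end OracleComputable

/-! ### Certificates for upper bounds of the pressure

All computations are done with natural numbers: potentials are shifted by a natural number `C` and
multiplied by `n + 2`, and exponentials are replaced by powers of `(n + 2) / (n + 1)`. -/

section Certificate

/-- A natural number slightly above `(n + 2) * (r + C)`. -/
def scaledEntry (n C : ℕ) (r : RatCode) : ℕ :=
  (r.1 + C * (r.2.2 + 1) - r.2.1) * (n + 2) / (r.2.2 + 1) + 3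

/-- Rounding down costs less than `1` of the added `3`. The remaining `2` pays for the oracle error,
as `(n + 2) * 2⁻ⁿ ≤ 2`. Truncated subtraction can only increase the entry, so no condition on `C` is
needed. -/
theorem scaledEntry_ge (n C : ℕ) (r : RatCode) :
    ((n : ℝ) + 2) * ((r.val : ℝ) + C) + 2 ≤ scaledEntry n C r := by
  obtain ⟨a, b, c⟩ := r
  have h1 : (a + C * (c + 1) - b) * (n + 2) <
      ((a + C * (c + 1) - b) * (n + 2) / (c + 1) + 1) * (c + 1) := by
    rw [mul_comm (_ / _ + 1)]
    exact Nat.lt_mul_div_succ _ (Nat.succ_pos c)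
  have h2 : a + C * (c + 1) ≤ (a + C * (c + 1) - b) + b := by omega
  simp only [scaledEntry, RatCode.val]
  generalize a + C * (c + 1) - b = e at *
  generalize e * (n + 2) / (c + 1) = f at *
  have h1' : (e : ℝ) * (n + 2) < (f + 1) * (c + 1) := by exact_mod_cast h1
  have h2' : (a : ℝ) + C * (c + 1) ≤ e + b := by exact_mod_cast h2
  have hc : (0 : ℝ) < c + 1 := by positivity
  push_cast
  have h3 : ((a : ℝ) - b) / (c + 1) + C ≤ e / (c + 1) := by
    rw [div_add' _ _ _ hc.ne']
    gcongr
    linarith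
  have h4 : (e : ℝ) / (c + 1) * (n + 2) < f + 1 := by
    rw [div_mul_eq_mul_div, div_lt_iff₀ hc]
    exact h1'
  have h5 : (((a : ℝ) - b) / (c + 1) + C) * (n + 2) ≤ e / (c + 1) * (n + 2) := by gcongr
  linarith

theorem scaledEntry_le {n C : ℕ} {r : RatCode} (h : 0 ≤ (r.val : ℝ) + C) :
    (scaledEntry n C r : ℝ) ≤ ((n : ℝ) + 2) * ((r.val : ℝ) + C) + 3 := by
  obtain ⟨a, b, c⟩ := r
  have hc : (0 : ℝ) < c + 1 := by positivity
  simp only [scaledEntry, RatCode.val] at *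
  push_cast at *
  rw [div_add' _ _ _ hc.ne'] at *
  have h2 : b ≤ a + C * (c + 1) := by
    have := (div_nonneg_iff.1 h).resolve_right fun h' => by linarith [h'.2]
    have : (b : ℝ) ≤ a + C * (c + 1) := by linarith [this.1]
    exact_mod_cast this
  have h3 : (((a + C * (c + 1) - b) * (n + 2) / (c + 1) : ℕ) : ℝ) ≤
      ((a + C * (c + 1) - b : ℕ) : ℝ) * (n + 2) / (c + 1) := by
    refine Nat.cast_div_le.trans ?_
    push_cast
    rfl
  push_cast [Nat.cast_sub h2] at h3
  calc _ ≤ ((a : ℝ) + C * (c + 1) - b) * (n + 2) / (c + 1) + 3 := by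
        linarith
    _ = _ := by ring

/-- The sum of the scaled entries of `q`, a bound for each of them. -/
def entryBound (n C : ℕ) (q : List RatCode) : ℕ := (q.map (scaledEntry n C)).sum

/-- The scaled entry of the potential represented by `(k, q)` (relative to the listing `L`) for the
window of radius `k` around position `i` of the word `w`, or a common upper bound of all entries if
the window does not fit into `w`. -/
def windowEntry (n C k : ℕ) (q : List RatCode) (L : List (List ℕ)) (w : List ℕ) (i : ℕ) : ℕ :=
  if k ≤ i then
    (q[L.idxOf ((w.drop (i - k)).take (2 * k + 1))]?.map (scaledEntry n C)).getD (entryBound n C q)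
  else entryBound n C q

/-- The sum of the scaled entries over all positions of the word `w`. -/
def wordWeight (n C k : ℕ) (q : List RatCode) (L : List (List ℕ)) (w : List ℕ) : ℕ :=
  ((List.range w.length).map (windowEntry n C k q L w)).sum

/-- The list `l` without repetitions. -/
def distinct (l : List (List ℕ)) : List (List ℕ) := l.foldr List.insert []

/-- The inequality `∑ w, ((n + 2) / (n + 1)) ^ (weight of w) ≤ ((n + 2) / (n + 1)) ^ p`, where `w`
ranges over the words in `W`. -/
def IsCertificate (n C p k : ℕ) (q : List RatCode) (L W : List (List ℕ)) : Prop :=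
  ((distinct W).map fun w =>
    (n + 2) ^ wordWeight n C k q L w * (n + 1) ^ (p - wordWeight n C k q L w)).sum ≤ (n + 2) ^ p

/-- The upper bound `p / ((n + 1) * (2 * m + 1)) - C` for the pressure. -/
def certifiedBound (n C m p : ℕ) : RatCode :=
  (p, C * ((n + 1) * (2 * m + 1)), (n + 1) * (2 * m + 1) - 1)

theorem val_certifiedBound (n C m p : ℕ) :
    ((certifiedBound n C m p).val : ℝ) = p / ((n + 1) * (2 * m + 1)) - C := by
  have h : 1 ≤ (n + 1) * (2 * m + 1) := Nat.mul_pos n.succ_pos (2 * m).succ_pos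
  simp only [certifiedBound, RatCode.val]
  push_cast [Nat.cast_sub h]
  field_simp
  ring

theorem nodup_distinct (l : List (List ℕ)) : (distinct l).Nodup := by
  induction l with
  | nil => exact List.nodup_nil
  | cons a l ih => exact ih.insert

theorem mem_distinct {l : List (List ℕ)} {w : List ℕ} : w ∈ distinct l ↔ w ∈ l := by
  induction l with
  | nil => rfl
  | cons a l ih =>
    rw [List.mem_cons, ← ih]
    exact List.mem_insert_iff

/-! #### The arithmetic of certificates -/

theorem inv_le_log_ratio (n : ℕ) : ((n : ℝ) + 2)⁻¹ ≤ Real.log (((n : ℝ) + 2) / (n + 1)) := by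
  refine le_trans (le_of_eq ?_) (Real.one_sub_inv_le_log_of_pos (by positivity))
  field_simp
  ring

theorem log_ratio_le_inv (n : ℕ) : Real.log (((n : ℝ) + 2) / (n + 1)) ≤ ((n : ℝ) + 1)⁻¹ := by
  refine (Real.log_le_sub_one_of_pos (by positivity)).trans (le_of_eq ?_)
  field_simp
  ring

theorem ratio_pow_eq_exp (n t : ℕ) : (((n : ℝ) + 2) / (n + 1)) ^ t =
    Real.exp (t * Real.log (((n : ℝ) + 2) / (n + 1))) := by
  rw [← Real.log_pow, Real.exp_log (by positivity)]

/-- If all `t a ≤ p`, this is multiplication by `(n + 1) ^ p`. If some `t a > p`, the truncated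
exponent `p - t a` is `0`, and that single term already violates both inequalities. -/
theorem sum_mul_le_iff {σ : Type*} (s : Finset σ) (t : σ → ℕ) (n p : ℕ) :
    ∑ a ∈ s, (n + 2) ^ t a * (n + 1) ^ (p - t a) ≤ (n + 2) ^ p ↔
      ∑ a ∈ s, (((n : ℝ) + 2) / (n + 1)) ^ t a ≤ (((n : ℝ) + 2) / (n + 1)) ^ p := by
  have hy : 1 < ((n : ℝ) + 2) / (n + 1) := by
    rw [one_lt_div (by positivity)]
    linarith
  have key (h : ∀ a ∈ s, t a ≤ p) :
      ((∑ a ∈ s, (n + 2) ^ t a * (n + 1) ^ (p - t a) : ℕ) : ℝ) =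
        (∑ a ∈ s, (((n : ℝ) + 2) / (n + 1)) ^ t a) * (n + 1) ^ p := by
    rw [Finset.sum_mul]
    push_cast
    refine Finset.sum_congr rfl fun a ha => ?_
    rw [← Nat.sub_add_cancel (h a ha), pow_add, Nat.add_sub_cancel, div_pow]
    field_simp
  by_cases h : ∀ a ∈ s, t a ≤ p
  · rw [← Nat.cast_le (α := ℝ), key h, ← le_div_iff₀ (by positivity)]
    push_cast
    rw [← div_pow]
  push Not at h
  obtain ⟨a, ha, hap⟩ := h
  refine iff_of_false (fun h => ?_) (fun h => ?_)
  · have h1 := (Finset.single_le_sum (f := fun a => (n + 2) ^ t a * (n + 1) ^ (p - t a))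
      (fun _ _ => Nat.zero_le _) ha).trans h
    simp only [Nat.sub_eq_zero_of_le hap.le, pow_zero, mul_one] at h1
    exact absurd h1 (not_le.2 (Nat.pow_lt_pow_right (by omega) hap))
  · have h1 := (Finset.single_le_sum (f := fun a => (((n : ℝ) + 2) / (n + 1)) ^ t a)
      (fun _ _ => by positivity) ha).trans h
    exact absurd h1 (not_le.2 (pow_lt_pow_right₀ hy hap))

theorem sum_exp_le_of_certificate {σ : Type*} {s : Finset σ} {t : σ → ℕ} {n p : ℕ}
    (h : ∑ a ∈ s, (n + 2) ^ t a * (n + 1) ^ (p - t a) ≤ (n + 2) ^ p) :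
    ∑ a ∈ s, Real.exp (t a / ((n : ℝ) + 2)) ≤ Real.exp (p / ((n : ℝ) + 1)) := by
  rw [sum_mul_le_iff] at h
  refine le_trans (Finset.sum_le_sum fun a _ => ?_) (h.trans ?_)
  · rw [ratio_pow_eq_exp, Real.exp_le_exp, div_eq_mul_inv]
    gcongr
    exact inv_le_log_ratio n
  · rw [ratio_pow_eq_exp, Real.exp_le_exp, div_eq_mul_inv (p : ℝ)]
    gcongr
    exact log_ratio_le_inv n

/-- The witness is the least `p` with `p * log ((n + 2) / (n + 1)) ≥ y`. Since the logarithm is at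
least `1/(n+2)`, rounding up gives the stated bound on `p`. -/
theorem exists_certificate_of_sum_exp_le {σ : Type*} {s : Finset σ} {t : σ → ℕ} {n : ℕ} {y : ℝ}
    (hy : 0 ≤ y) (h : ∑ a ∈ s, Real.exp (t a / ((n : ℝ) + 1)) ≤ Real.exp y) :
    ∃ p : ℕ, ∑ a ∈ s, (n + 2) ^ t a * (n + 1) ^ (p - t a) ≤ (n + 2) ^ p ∧
      (p : ℝ) ≤ (n + 2) * y + 1 := by
  have hl := inv_le_log_ratio n
  have hl0 : 0 < Real.log (((n : ℝ) + 2) / (n + 1)) := lt_of_lt_of_le (by positivity) hl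
  refine ⟨⌈y / Real.log (((n : ℝ) + 2) / (n + 1))⌉₊, ?_, ?_⟩
  · rw [sum_mul_le_iff]
    refine le_trans (Finset.sum_le_sum fun a _ => ?_) (h.trans ?_)
    · rw [ratio_pow_eq_exp, Real.exp_le_exp, div_eq_mul_inv (t a : ℝ)]
      gcongr
      exact log_ratio_le_inv n
    · rw [ratio_pow_eq_exp, Real.exp_le_exp, ← div_le_iff₀ hl0]
      exact Nat.le_ceil _
  · refine (Nat.ceil_lt_add_one (by positivity)).le.trans ?_
    gcongr
    rw [div_le_iff₀ hl0]
    have : (n + 2 : ℝ) * (n + 2 : ℝ)⁻¹ ≤ (n + 2) * Real.log (((n : ℝ) + 2) / (n + 1)) := by gcongr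
    rw [mul_inv_cancel₀ (by positivity)] at this
    nlinarith

end Certificate

/-! ### Soundness and completeness of certificates -/

section WordWeight

variable {d : ℕ} {X : Subshift (Fin d) ℤ} {φ : C(X.carrier, ℝ)} {ψ : ℕ → List (List ℕ)}
  {k n C : ℕ} {q : List RatCode} {g : C(X.carrier, ℝ)}

theorem wordList_injective {n : ℕ} : Function.Injective (wordList : (Fin n → Fin d) → List ℕ) :=
  fun τ τ' h => by
    ext i
    exact congrFun (List.ofFn_injective h) i

@[simp] theorem length_wordList {n : ℕ} (τ : Fin n → Fin d) : (wordList τ).length = n := by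
  simp [wordList]

theorem take_drop_wordList_substring (x : ℤ → Fin d) {j l N : ℕ} (h : j + l ≤ N) :
    ((wordList (substring x 0 N)).drop j).take l = wordList (substring x j l) := by
  refine List.ext_getElem (by simp; omega) fun i _ _ => ?_
  simp [wordList, substring]

/-- The oracle may list a word several times; removing repetitions makes the list sum a sum over the
language. -/
theorem sum_distinct (hψ : IsLanguageOracle X ψ) (m : ℕ) (f : List ℕ → ℕ) :
    ((distinct (ψ m)).map f).sum =
      ∑ τ ∈ (Set.toFinite (language X (2 * m + 1))).toFinset, f (wordList τ) := by
  classical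
  rw [← List.sum_toFinset f (nodup_distinct _),
    ← Finset.sum_image (f := f) wordList_injective.injOn]
  congr 1
  ext w
  simp [mem_distinct, hψ m w]

/-- The window of radius `k` around position `0` of `y` leads to the value of the represented
potential at `y`. -/
theorem Represents.exists_getElem?_idxOf (hψ : IsLanguageOracle X ψ) (hg : Represents X ψ k q g)
    (y : X.carrier) :
    ∃ r ∈ q, q[(ψ k).idxOf (wordList (substring y.1 (-(k : ℤ)) (2 * k + 1)))]? = some r ∧
      g y = (r.val : ℝ) := by
  set v := wordList (substring y.1 (-(k : ℤ)) (2 * k + 1))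
  have hmem : v ∈ ψ k := (hψ k v).2 ⟨_, substring_mem_language y _ _, rfl⟩
  have hlt : (ψ k).idxOf v < (ψ k).length := List.idxOf_lt_length_of_mem hmem
  have hlt' : (ψ k).idxOf v < q.length := hg.1 ▸ hlt
  refine ⟨q[(ψ k).idxOf v], List.getElem_mem _, List.getElem?_eq_getElem hlt', ?_⟩
  refine hg.2 y (v, q[(ψ k).idxOf v]) ?_ rfl
  have hz : (ψ k).idxOf v < ((ψ k).zip q).length := by simp [hlt, hlt']
  have := List.getElem_mem hz
  rwa [List.getElem_zip, List.getElem_idxOf] at this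

theorem scaledEntry_le_entryBound {r : RatCode} (hr : r ∈ q) :
    scaledEntry n C r ≤ entryBound n C q :=
  List.single_le_sum (fun _ _ => Nat.zero_le _) _ (List.mem_map_of_mem hr)

theorem windowEntry_of_lt (hψ : IsLanguageOracle X ψ) (hg : Represents X ψ k q g)
    (x : X.carrier) {i N : ℕ} (hk : k ≤ i) (hN : i + k < N) :
    ∃ r ∈ q, windowEntry n C k q (ψ k) (wordList (substring x.1 0 N)) i = scaledEntry n C r ∧
      g ((shiftMap X)^[i] x) = (r.val : ℝ) := by
  obtain ⟨r, hr, h1, h2⟩ := hg.exists_getElem?_idxOf hψ ((shiftMap X)^[i] x)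
  refine ⟨r, hr, ?_, h2⟩
  rw [substring_shiftMap_iterate] at h1
  rw [windowEntry, if_pos hk, take_drop_wordList_substring _ (by omega), Nat.cast_sub hk,
    sub_eq_add_neg, h1]
  rfl

theorem windowEntry_of_not_lt (hψ : IsLanguageOracle X ψ) (hg : Represents X ψ k q g)
    (x : X.carrier) {i N : ℕ} (h : ¬(k ≤ i ∧ i + k < N)) :
    windowEntry n C k q (ψ k) (wordList (substring x.1 0 N)) i = entryBound n C q := by
  unfold windowEntry
  split_ifs with hk
  · have hN : N ≤ i + k := by
      by_contra hN
      exact h ⟨hk, not_le.1 hN⟩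
    -- A window running over the right end is shorter than `2k + 1`, hence not in `ψ k`. Its index
    -- is then the length of the list, and the lookup falls back to the default.
    rw [List.idxOf_eq_length, ← hg.1, List.getElem?_eq_none le_rfl]
    · rfl
    · intro hmem
      obtain ⟨τ, -, hτ⟩ := (hψ k _).1 hmem
      have := congrArg List.length hτ
      simp at this
      omega
  · rfl

theorem add_le_scaledEntry {r : RatCode} (hgφ : ‖g - φ‖ < (2 : ℝ)⁻¹ ^ n) {y : X.carrier}
    (hr : g y = (r.val : ℝ)) : ((n : ℝ) + 2) * (φ y + C) ≤ scaledEntry n C r := by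
  refine le_trans ?_ (scaledEntry_ge n C r)
  have h1 : |g y - φ y| < (2 : ℝ)⁻¹ ^ n := ((g - φ).norm_coe_le_norm y).trans_lt hgφ
  have h2 : ((n : ℝ) + 2) * (2 : ℝ)⁻¹ ^ n ≤ 2 := by
    rw [inv_pow, ← div_eq_mul_inv, div_le_iff₀ (by positivity)]
    have : n + 2 ≤ 2 ^ (n + 1) := Nat.lt_two_pow_self
    rw [pow_succ'] at this
    exact_mod_cast this
  have h3 : φ y ≤ r.val + (2 : ℝ)⁻¹ ^ n := by
    rw [← hr]
    linarith [neg_abs_le (g y - φ y)]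
  have h4 : ((n : ℝ) + 2) * φ y ≤ (n + 2) * (r.val + (2 : ℝ)⁻¹ ^ n) := by gcongr
  linarith

theorem scaledEntry_le_add {r : RatCode} (hC : ‖φ‖ + 1 ≤ C) (hgφ : ‖g - φ‖ < (2 : ℝ)⁻¹ ^ n)
    {y : X.carrier} (hr : g y = (r.val : ℝ)) :
    (scaledEntry n C r : ℝ) ≤ ((n : ℝ) + 2) * (φ y + C) + 5 := by
  have h1 : |g y - φ y| < (2 : ℝ)⁻¹ ^ n := ((g - φ).norm_coe_le_norm y).trans_lt hgφ
  have h0 : (2 : ℝ)⁻¹ ^ n ≤ 1 := pow_le_one₀ (by norm_num) (by norm_num)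
  have h2 : ((n : ℝ) + 2) * (2 : ℝ)⁻¹ ^ n ≤ 2 := by
    rw [inv_pow, ← div_eq_mul_inv, div_le_iff₀ (by positivity)]
    have : n + 2 ≤ 2 ^ (n + 1) := Nat.lt_two_pow_self
    rw [pow_succ'] at this
    exact_mod_cast this
  have h3 : (r.val : ℝ) ≤ φ y + (2 : ℝ)⁻¹ ^ n := by
    rw [← hr]
    linarith [le_abs_self (g y - φ y)]
  have h5 : |φ y| ≤ ‖φ‖ := φ.norm_coe_le_norm y
  have h4 : ((n : ℝ) + 2) * r.val ≤ (n + 2) * (φ y + (2 : ℝ)⁻¹ ^ n) := by gcongr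
  have := scaledEntry_le (n := n) (C := C) (r := r) (by
    rw [← hr]
    linarith [neg_abs_le (g y - φ y), neg_abs_le (φ y)])
  linarith

theorem wordWeight_wordList {N : ℕ} (L : List (List ℕ)) (τ : Fin N → Fin d) :
    wordWeight n C k q L (wordList τ) =
      ∑ i ∈ Finset.range N, windowEntry n C k q L (wordList τ) i := by
  rw [wordWeight, length_wordList]
  rfl

/-- Inside the word each entry dominates `(n + 2) * (φ + C)` at the shifted point. Near the ends the
window is unknown, but the common bound dominates every possible entry. -/
theorem le_wordWeight (hψ : IsLanguageOracle X ψ) (hg : Represents X ψ k q g)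
    (hgφ : ‖g - φ‖ < (2 : ℝ)⁻¹ ^ n) (x : X.carrier) (N : ℕ) :
    ((n : ℝ) + 2) * (birkhoffSum (shiftMap X) φ N x + N * C) ≤
      wordWeight n C k q (ψ k) (wordList (substring x.1 0 N)) := by
  have h : birkhoffSum (shiftMap X) φ N x + N * C =
      ∑ i ∈ Finset.range N, (φ ((shiftMap X)^[i] x) + C) := by
    simp [birkhoffSum, Finset.sum_add_distrib]
  rw [h, Finset.mul_sum, wordWeight_wordList, Nat.cast_sum]
  refine Finset.sum_le_sum fun i _ => ?_
  by_cases hi : k ≤ i ∧ i + k < N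
  · obtain ⟨r, -, hr, hr'⟩ := windowEntry_of_lt (n := n) (C := C) hψ hg x hi.1 hi.2
    rw [hr]
    exact add_le_scaledEntry hgφ hr'
  · obtain ⟨r, hr, -, hr'⟩ := hg.exists_getElem?_idxOf hψ ((shiftMap X)^[i] x)
    rw [windowEntry_of_not_lt hψ hg x hi]
    exact (add_le_scaledEntry hgφ hr').trans (Nat.cast_le.2 (scaledEntry_le_entryBound hr))

theorem card_margin_le (k N : ℕ) :
    ((Finset.range N).filter fun i => ¬(k ≤ i ∧ i + k < N)).card ≤ 2 * k := by
  refine (Finset.card_le_card (t := Finset.range k ∪ Finset.Ico (N - k) N) fun i hi => ?_).trans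
    ((Finset.card_union_le _ _).trans ?_)
  · simp only [Finset.mem_filter, Finset.mem_range, Finset.mem_union, Finset.mem_Ico] at hi ⊢
    omega
  · simp only [Finset.card_range, Nat.card_Ico]
    omega

/-- Each inner position loses at most `5`. At most `2k` positions lie near the ends, and there `φ +
C ≥ 0` allows the whole common bound to be counted as error, independently of `N`. -/
theorem wordWeight_le (hψ : IsLanguageOracle X ψ) (hg : Represents X ψ k q g)
    (hC : ‖φ‖ + 1 ≤ C) (hgφ : ‖g - φ‖ < (2 : ℝ)⁻¹ ^ n) (x : X.carrier) (N : ℕ) :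
    (wordWeight n C k q (ψ k) (wordList (substring x.1 0 N)) : ℝ) ≤
      ((n : ℝ) + 2) * (birkhoffSum (shiftMap X) φ N x + N * C) + 5 * N +
        2 * k * entryBound n C q := by
  have h : ((n : ℝ) + 2) * (birkhoffSum (shiftMap X) φ N x + N * C) + 5 * N =
      ∑ i ∈ Finset.range N, (((n : ℝ) + 2) * (φ ((shiftMap X)^[i] x) + C) + 5) := by
    rw [Finset.sum_add_distrib, ← Finset.mul_sum]
    simp [birkhoffSum, Finset.sum_add_distrib]
    ring
  have h' : ∑ i ∈ Finset.range N, (if ¬(k ≤ i ∧ i + k < N) then (entryBound n C q : ℝ) else 0) ≤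
      2 * k * entryBound n C q := by
    rw [← Finset.sum_filter, Finset.sum_const, nsmul_eq_mul]
    gcongr
    exact_mod_cast card_margin_le k N
  refine le_trans ?_ (add_le_add h.ge h')
  rw [← Finset.sum_add_distrib, wordWeight_wordList, Nat.cast_sum]
  refine Finset.sum_le_sum fun i _ => ?_
  by_cases hi : k ≤ i ∧ i + k < N
  · obtain ⟨r, -, hr, hr'⟩ := windowEntry_of_lt (n := n) (C := C) hψ hg x hi.1 hi.2
    rw [hr, if_neg (not_not.2 hi), add_zero]
    exact scaledEntry_le_add hC hgφ hr'
  · rw [windowEntry_of_not_lt hψ hg x hi, if_pos hi]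
    have h5 : |φ ((shiftMap X)^[i] x)| ≤ ‖φ‖ := φ.norm_coe_le_norm _
    have : 0 ≤ φ ((shiftMap X)^[i] x) + C := by
      linarith [neg_abs_le (φ ((shiftMap X)^[i] x))]
    have : 0 ≤ ((n : ℝ) + 2) * (φ ((shiftMap X)^[i] x) + C) := by positivity
    linarith

/-- Soundness holds for every `C`, so the machine needs no bound for `‖φ‖`. -/
theorem pressure_le_certifiedBound (hX : X.carrier.Nonempty) (hψ : IsLanguageOracle X ψ)
    (hg : Represents X ψ k q g) (hgφ : ‖g - φ‖ < (2 : ℝ)⁻¹ ^ n) {m p : ℕ}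
    (h : IsCertificate n C p k q (ψ k) (ψ m)) :
    pressure X φ ≤ (certifiedBound n C m p).val := by
  rw [IsCertificate, sum_distinct hψ] at h
  have h1 := sum_exp_le_of_certificate h
  have h2 := partitionFunction_le_sum_exp φ (n := 2 * m + 1) (fun τ =>
    wordWeight n C k q (ψ k) (wordList τ) / ((n : ℝ) + 2) + -((2 * m + 1 : ℕ) * C)) fun x => by
      have := le_wordWeight (C := C) hψ hg hgφ x (2 * m + 1)
      rw [← le_div_iff₀' (by positivity)] at this
      linarith
  simp only [Real.exp_add, ← Finset.sum_mul] at h2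
  have h3 : partitionFunction X φ (2 * m + 1) ≤
      Real.exp (p / ((n : ℝ) + 1) + -((2 * m + 1 : ℕ) * C)) := by
    rw [Real.exp_add]
    exact h2.trans (by gcongr)
  refine (pressure_le φ hX (n := 2 * m + 1) (by omega)).trans ?_
  have h4 := (Real.log_le_iff_le_exp (partitionFunction_pos φ hX _)).2 h3
  rw [val_certifiedBound, one_div_mul_eq_div, div_le_iff₀ (by positivity)]
  refine h4.trans (le_of_eq ?_)
  push_cast
  field_simp
  ring

theorem exists_certificate (hX : X.carrier.Nonempty) (hψ : IsLanguageOracle X ψ)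
    (hg : Represents X ψ k q g) (hC : ‖φ‖ + 1 ≤ C) (hgφ : ‖g - φ‖ < (2 : ℝ)⁻¹ ^ n) (m : ℕ) :
    ∃ p, IsCertificate n C p k q (ψ k) (ψ m) ∧
      ((certifiedBound n C m p).val : ℝ) ≤
        (1 + ((n : ℝ) + 1)⁻¹) *
          (1 / ((2 * m + 1 : ℕ) : ℝ) * Real.log (partitionFunction X φ (2 * m + 1)) + C +
            (2 * C + 5) * ((n : ℝ) + 1)⁻¹ +
            2 * k * entryBound n C q * ((n : ℝ) + 1)⁻¹ / ((2 * m + 1 : ℕ) : ℝ)) +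
          ((n : ℝ) + 1)⁻¹ / ((2 * m + 1 : ℕ) : ℝ) - C := by
  set N := 2 * m + 1 with hN
  set B := entryBound n C q
  have hNpos : (0 : ℝ) < N := by positivity
  have hn : (0 : ℝ) < n + 1 := by positivity
  set Λ := Real.log (partitionFunction X φ N) + N * C +
    (N * (2 * C + 5) + 2 * k * B) * ((n : ℝ) + 1)⁻¹ with hΛ
  have hφ := norm_nonneg φ
  have hS (x : X.carrier) : birkhoffSum (shiftMap X) φ N x ≤ N * C := by
    have : (N : ℝ) * ‖φ‖ ≤ N * C := by
      gcongr
      linarith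
    linarith [le_abs_self (birkhoffSum (shiftMap X) φ N x), abs_birkhoffSum_le φ N x]
  -- The shift by `C` compensates `log Z_N ≥ -N‖φ‖`; nonnegativity is needed for rounding up to a
  -- natural `p`.
  have hΛ0 : 0 ≤ Λ := by
    have h1 := (Real.le_log_iff_exp_le (partitionFunction_pos φ hX N)).2
      (exp_neg_le_partitionFunction φ hX N)
    have : (N : ℝ) * ‖φ‖ ≤ N * C := by
      gcongr
      linarith
    have : 0 ≤ (N * (2 * C + 5) + 2 * k * B) * ((n : ℝ) + 1)⁻¹ := by positivity
    linarith
  have hsum : ∑ τ ∈ (Set.toFinite (language X N)).toFinset,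
      Real.exp (wordWeight n C k q (ψ k) (wordList τ) / ((n : ℝ) + 1)) ≤ Real.exp Λ := by
    have h2 := sum_exp_le_partitionFunction φ (n := N) (fun τ =>
      wordWeight n C k q (ψ k) (wordList τ) / ((n : ℝ) + 1) +
        -(N * C + (N * (2 * C + 5) + 2 * k * B) * ((n : ℝ) + 1)⁻¹)) fun x => by
        have h3 := wordWeight_le hψ hg hC hgφ x N
        rw [← sub_eq_add_neg, sub_le_iff_le_add, div_le_iff₀ hn]
        -- Replacing the factor `n + 2` by `n + 1` costs one copy of `S_N φ + N C ≤ 2 N C`, the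
        -- source of the `2 * C` in `Λ`.
        have h4 : (birkhoffSum (shiftMap X) φ N x +
            (N * C + (N * (2 * C + 5) + 2 * k * B) * ((n : ℝ) + 1)⁻¹)) * (n + 1) =
            (birkhoffSum (shiftMap X) φ N x + N * C) * (n + 1) + (N * (2 * C + 5) + 2 * k * B) := by
          field_simp
          ring
        rw [h4]
        linarith [hS x]
    simp only [Real.exp_add _ (-_), ← Finset.sum_mul] at h2
    rw [Real.exp_neg, ← div_eq_mul_inv, div_le_iff₀ (Real.exp_pos _)] at h2
    rw [hΛ, add_assoc, Real.exp_add, Real.exp_log (partitionFunction_pos φ hX N)]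
    exact h2
  obtain ⟨p, hp, hp'⟩ := exists_certificate_of_sum_exp_le hΛ0 hsum
  refine ⟨p, ?_, ?_⟩
  · rw [IsCertificate, sum_distinct hψ]
    exact hp
  · rw [val_certifiedBound]
    have hN' : (2 * m + 1 : ℝ) = N := by
      rw [hN]
      push_cast
      rfl
    rw [hN']
    gcongr
    rw [div_le_iff₀ (by positivity)]
    refine hp'.trans (le_of_eq ?_)
    rw [hΛ]
    field_simp
    ring

end WordWeight

/-! ### The machine -/

instance (n C p k : ℕ) (q : List RatCode) (L W : List (List ℕ)) :
    Decidable (IsCertificate n C p k q L W) := Nat.decLe _ _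

/-- The smaller of the two rational numbers denoted by `r` and `s`. -/
def RatCode.min (r s : RatCode) : RatCode :=
  if r.1 * (s.2.2 + 1) + s.2.1 * (r.2.2 + 1) ≤ s.1 * (r.2.2 + 1) + r.2.1 * (s.2.2 + 1) then r
  else s

theorem RatCode.val_min (r s : RatCode) : (r.min s).val = Min.min r.val s.val := by
  obtain ⟨a, b, c⟩ := r
  obtain ⟨a', b', c'⟩ := s
  have h : a * (c' + 1) + b' * (c + 1) ≤ a' * (c + 1) + b * (c' + 1) ↔
      RatCode.val (a, b, c) ≤ RatCode.val (a', b', c') := by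
    rw [RatCode.val, RatCode.val, div_le_div_iff₀ (by positivity) (by positivity), sub_mul,
      sub_mul, sub_le_sub_iff, ← Nat.cast_le (α := ℚ)]
    push_cast
    rfl
  unfold RatCode.min
  split_ifs with hle
  · exact (min_eq_left (h.1 hle)).symm
  · exact (min_eq_right (not_le.1 (mt h.2 hle)).le).symm

/-! ### Primitive recursiveness of the certificate test -/

section Primrec

variable {α : Type} [Primcodable α]

theorem primrec_pow {f g : α → ℕ} (hf : Primrec f) (hg : Primrec g) :
    Primrec fun a => f a ^ g a :=
  (Primrec₂.unpaired'.1 Nat.Primrec.pow).comp hf hg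

theorem primrec_add {f g : α → ℕ} (hf : Primrec f) (hg : Primrec g) :
    Primrec fun a => f a + g a :=
  Primrec.nat_add.comp hf hg

theorem primrec_mul {f g : α → ℕ} (hf : Primrec f) (hg : Primrec g) :
    Primrec fun a => f a * g a :=
  Primrec.nat_mul.comp hf hg

theorem primrec_sub {f g : α → ℕ} (hf : Primrec f) (hg : Primrec g) :
    Primrec fun a => f a - g a :=
  Primrec.nat_sub.comp hf hg

theorem primrec_list_sum {f : α → List ℕ} (hf : Primrec f) : Primrec fun a => (f a).sum :=
  Primrec.list_foldr hf (Primrec.const 0)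
    (primrec_add (Primrec.fst.comp Primrec.snd) (Primrec.snd.comp Primrec.snd)).to₂

theorem primrec_ratCodeMin {f g : α → RatCode} (hf : Primrec f) (hg : Primrec g) :
    Primrec fun a => (f a).min (g a) := by
  have h1 : Primrec fun a => (f a).2.2 + 1 :=
    Primrec.succ.comp (Primrec.snd.comp (Primrec.snd.comp hf))
  have h2 : Primrec fun a => (g a).2.2 + 1 :=
    Primrec.succ.comp (Primrec.snd.comp (Primrec.snd.comp hg))
  have h3 := Primrec.fst.comp (Primrec.snd.comp hf)
  have h4 := Primrec.fst.comp (Primrec.snd.comp hg)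
  exact Primrec.ite (Primrec.nat_le.comp
    (primrec_add (primrec_mul (Primrec.fst.comp hf) h2) (primrec_mul h4 h1))
    (primrec_add (primrec_mul (Primrec.fst.comp hg) h1) (primrec_mul h3 h2))) hf hg

variable {n C k : α → ℕ} {q : α → List RatCode} {L : α → List (List ℕ)} {w : α → List ℕ}

theorem primrec_scaledEntry {r : α → RatCode} (hn : Primrec n) (hC : Primrec C)
    (hr : Primrec r) : Primrec fun a => scaledEntry (n a) (C a) (r a) := by
  have hc : Primrec fun a => (r a).2.2 + 1 :=
    Primrec.succ.comp (Primrec.snd.comp (Primrec.snd.comp hr))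
  exact primrec_add (Primrec.nat_div.comp (primrec_mul (primrec_sub
    (primrec_add (Primrec.fst.comp hr) (primrec_mul hC hc)) (Primrec.fst.comp (Primrec.snd.comp hr)))
    (primrec_add hn (Primrec.const 2))) hc) (Primrec.const 3)

theorem primrec_entryBound (hn : Primrec n) (hC : Primrec C) (hq : Primrec q) :
    Primrec fun a => entryBound (n a) (C a) (q a) :=
  primrec_list_sum (Primrec.list_map hq (primrec_scaledEntry (hn.comp Primrec.fst)
    (hC.comp Primrec.fst) Primrec.snd).to₂)

theorem primrec_list_idxOf (hw : Primrec w) (hL : Primrec L) :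
    Primrec fun a => (L a).idxOf (w a) :=
  (Primrec.list_idxOf.comp hw hL).of_eq fun a => by
    -- The two sides may use different Boolean equality tests; lawful ones coincide.
    congr 1
    exact lawful_beq_subsingleton _ _

theorem primrec_windowEntry {i : α → ℕ} (hn : Primrec n) (hC : Primrec C) (hk : Primrec k)
    (hq : Primrec q) (hL : Primrec L) (hw : Primrec w) (hi : Primrec i) :
    Primrec fun a => windowEntry (n a) (C a) (k a) (q a) (L a) (w a) (i a) := by
  have hB := primrec_entryBound hn hC hq
  refine Primrec.ite (Primrec.nat_le.comp hk hi) (Primrec.option_getD.comp (Primrec.option_map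
    (Primrec.list_getElem?.comp hq (primrec_list_idxOf ?_ hL)) ?_) hB) hB
  · exact Primrec.list_take.comp (primrec_add (primrec_mul (Primrec.const 2) hk) (Primrec.const 1))
      (Primrec.list_drop.comp (primrec_sub hi hk) hw)
  · exact (primrec_scaledEntry (hn.comp Primrec.fst) (hC.comp Primrec.fst) Primrec.snd).to₂

theorem primrec_wordWeight (hn : Primrec n) (hC : Primrec C) (hk : Primrec k)
    (hq : Primrec q) (hL : Primrec L) (hw : Primrec w) :
    Primrec fun a => wordWeight (n a) (C a) (k a) (q a) (L a) (w a) :=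
  primrec_list_sum (Primrec.list_map (Primrec.list_range.comp (Primrec.list_length.comp hw))
    (primrec_windowEntry (hn.comp Primrec.fst) (hC.comp Primrec.fst) (hk.comp Primrec.fst)
      (hq.comp Primrec.fst) (hL.comp Primrec.fst) (hw.comp Primrec.fst) Primrec.snd).to₂)

theorem primrec_list_insert {l : α → List (List ℕ)} (hw : Primrec w) (hl : Primrec l) :
    Primrec fun a => (l a).insert (w a) := by
  refine (Primrec.ite (Primrec.nat_lt.comp (primrec_list_idxOf hw hl)
    (Primrec.list_length.comp hl)) hl (Primrec.list_cons.comp hw hl)).of_eq fun a => ?_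
  simp [List.insert, List.idxOf_lt_length_iff]

theorem primrec_distinct (hL : Primrec L) : Primrec fun a => distinct (L a) :=
  Primrec.list_foldr hL (Primrec.const []) (primrec_list_insert
    (Primrec.fst.comp Primrec.snd) (Primrec.snd.comp Primrec.snd)).to₂

theorem primrec_decide_isCertificate {p : α → ℕ} {W : α → List (List ℕ)} (hn : Primrec n)
    (hC : Primrec C) (hp : Primrec p) (hk : Primrec k) (hq : Primrec q) (hL : Primrec L)
    (hW : Primrec W) :
    Primrec fun a => decide (IsCertificate (n a) (C a) (p a) (k a) (q a) (L a) (W a)) := by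
  have hn1 : Primrec fun a => n a + 1 := Primrec.succ.comp hn
  have hn2 : Primrec fun a => n a + 2 := primrec_add hn (Primrec.const 2)
  have ht := primrec_wordWeight (α := α × List ℕ) (hn.comp Primrec.fst) (hC.comp Primrec.fst)
    (hk.comp Primrec.fst) (hq.comp Primrec.fst) (hL.comp Primrec.fst) Primrec.snd
  refine primrecPred_iff_primrec_decide.1 (Primrec.nat_le.comp (primrec_list_sum
    (Primrec.list_map (primrec_distinct hW) ?_)) (primrec_pow hn2 hp))
  exact (primrec_mul (primrec_pow (hn2.comp Primrec.fst) ht)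
    (primrec_pow (hn1.comp Primrec.fst) (primrec_sub (hp.comp Primrec.fst) ht))).to₂

theorem primrec_certifiedBound {m p : α → ℕ} (hn : Primrec n) (hC : Primrec C) (hm : Primrec m)
    (hp : Primrec p) : Primrec fun a => certifiedBound (n a) (C a) (m a) (p a) := by
  have h : Primrec fun a => (n a + 1) * (2 * m a + 1) := primrec_mul (Primrec.succ.comp hn)
    (Primrec.succ.comp (primrec_mul (Primrec.const 2) hm))
  exact hp.pair ((primrec_mul hC h).pair (primrec_sub h (Primrec.const 1)))

end Primrec

/-- The parameters `(n, C, m, p)` of the `j`-th candidate for a certificate. -/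
def candidate (j : ℕ) : ℕ × ℕ × ℕ × ℕ := Denumerable.ofNat _ j

theorem primrec_candidate : Primrec candidate := Primrec.ofNat _

/-- Whether the parameters `a.1` are a certificate relative to the oracle values `a.2`. -/
def checkTuple (a : (ℕ × ℕ × ℕ × ℕ) × (ℕ × List RatCode) × List (List ℕ) × List (List ℕ)) :
    Bool :=
  decide (IsCertificate a.1.1 a.1.2.1 a.1.2.2.2 a.2.1.1 a.2.1.2 a.2.2.1 a.2.2.2)

theorem primrec_checkTuple : Primrec checkTuple := by
  have h1 := Primrec.snd (α := ℕ × ℕ × ℕ × ℕ)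
    (β := (ℕ × List RatCode) × List (List ℕ) × List (List ℕ))
  have h2 := Primrec.fst (α := ℕ × ℕ × ℕ × ℕ)
    (β := (ℕ × List RatCode) × List (List ℕ) × List (List ℕ))
  exact primrec_decide_isCertificate (Primrec.fst.comp h2)
    (Primrec.fst.comp (Primrec.snd.comp h2))
    (Primrec.snd.comp (Primrec.snd.comp (Primrec.snd.comp h2)))
    (Primrec.fst.comp (Primrec.fst.comp h1)) (Primrec.snd.comp (Primrec.fst.comp h1))
    (Primrec.fst.comp (Primrec.snd.comp h1)) (Primrec.snd.comp (Primrec.snd.comp h1))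

/-- Whether the `j`-th candidate is a certificate relative to the oracles `ω = (ψ, χ)`. -/
def checkCandidate (ω : (ℕ → List (List ℕ)) × (ℕ → ℕ × List RatCode)) (j : ℕ) : Bool :=
  checkTuple (candidate j, ω.2 (candidate j).1, ω.1 (ω.2 (candidate j).1).1,
    ω.1 (candidate j).2.2.1)

/-- The bound that belongs to the `j`-th candidate. -/
def candidateBound (j : ℕ) : RatCode :=
  certifiedBound (candidate j).1 (candidate j).2.1 (candidate j).2.2.1 (candidate j).2.2.2

/-- Pairs of oracles for which there is a certificate. -/
abbrev CertifiedOracles : Type :=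
  {ω : (ℕ → List (List ℕ)) × (ℕ → ℕ × List RatCode) // ∃ j, checkCandidate ω j = true}

/-- The least bound that belongs to one of the certificates among the first `i` candidates and the
first certificate. -/
def bestBound (ω : CertifiedOracles) (i : ℕ) : RatCode :=
  Nat.rec (motive := fun _ => RatCode) (candidateBound (Nat.find ω.2))
    (fun j b => cond (checkCandidate ω.1 j) ((candidateBound j).min b) b) i

/-- Restricting the parameter to `CertifiedOracles` makes the initial search terminate. The program
itself depends on neither the oracles nor `d`, `X` and `φ`. -/
theorem oracleComputable_bestBound :
    OracleComputable (fun ω : CertifiedOracles => oracles ω.1.1 ω.1.2) bestBound := by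
  set O := fun ω : CertifiedOracles => oracles ω.1.1 ω.1.2
  have hψ : OracleComputable O fun ω => ω.1.1 := .query 0 fun _ _ => rfl
  have hχ : OracleComputable O fun ω => ω.1.2 := .query 1 fun _ _ => rfl
  have hc : OracleComputable O fun _ => candidate := .of_primrec primrec_candidate
  have hkq : OracleComputable O fun ω j => ω.1.2 (candidate j).1 :=
    hχ.comp ((OracleComputable.of_primrec Primrec.fst).comp hc)
  have hL : OracleComputable O fun ω j => ω.1.1 (ω.1.2 (candidate j).1).1 :=
    hψ.comp ((OracleComputable.of_primrec Primrec.fst).comp hkq)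
  have hW : OracleComputable O fun ω j => ω.1.1 (candidate j).2.2.1 :=
    hψ.comp ((OracleComputable.of_primrec
      (Primrec.fst.comp (Primrec.snd.comp Primrec.snd))).comp hc)
  have hcheck : OracleComputable O fun ω => checkCandidate ω.1 := by
    exact (OracleComputable.of_primrec primrec_checkTuple).comp (hc.pair (hkq.pair (hL.pair hW)))
  have hbound : Primrec candidateBound := by
    have h2 := Primrec.snd.comp primrec_candidate
    exact primrec_certifiedBound (Primrec.fst.comp primrec_candidate) (Primrec.fst.comp h2)
      (Primrec.fst.comp (Primrec.snd.comp h2)) (Primrec.snd.comp (Primrec.snd.comp h2))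
  have hfind : OracleComputable O fun ω (_ : ℕ) => candidateBound (Nat.find ω.2) :=
    (OracleComputable.of_primrec hbound).comp (hcheck.find fun ω => ω.2)
  have hstep : OracleComputable O fun ω (a : ℕ × ℕ × RatCode) =>
      cond (checkCandidate ω.1 a.2.1) ((candidateBound a.2.1).min a.2.2) a.2.2 := by
    have h : Primrec fun a : Bool × ℕ × ℕ × RatCode =>
        cond a.1 ((candidateBound a.2.2.1).min a.2.2.2) a.2.2.2 := by
      have hb : Primrec fun a : Bool × ℕ × ℕ × RatCode => a.2.2.2 :=
        Primrec.snd.comp (Primrec.snd.comp Primrec.snd)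
      exact Primrec.cond Primrec.fst (primrec_ratCodeMin (hbound.comp
        (Primrec.fst.comp (Primrec.snd.comp Primrec.snd))) hb) hb
    exact (OracleComputable.of_primrec h).comp ((hcheck.comp (OracleComputable.of_primrec
      (Primrec.fst.comp Primrec.snd))).pair (OracleComputable.of_primrec Primrec.id))
  -- The input is duplicated: one copy is a dummy parameter, the other counts the recursion steps.
  exact (hfind.nat_rec hstep).comp
    (OracleComputable.of_primrec (Primrec.id.pair Primrec.id))

theorem antitone_bestBound (ω : CertifiedOracles) : Antitone fun i => (bestBound ω i).val := by
  refine antitone_nat_of_succ_le fun i => ?_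
  change (cond (checkCandidate ω.1 i) ((candidateBound i).min (bestBound ω i))
    (bestBound ω i)).val ≤ _
  cases checkCandidate ω.1 i
  · exact le_rfl
  · exact (RatCode.val_min _ _).trans_le (min_le_right _ _)

theorem bestBound_succ_le {ω : CertifiedOracles} {j : ℕ} (h : checkCandidate ω.1 j = true) :
    (bestBound ω (j + 1)).val ≤ (candidateBound j).val := by
  change (cond (checkCandidate ω.1 j) ((candidateBound j).min (bestBound ω j))
    (bestBound ω j)).val ≤ _
  rw [h]
  exact (RatCode.val_min _ _).trans_le (min_le_left _ _)

theorem le_bestBound {ω : CertifiedOracles} {y : ℝ}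
    (h : ∀ j, checkCandidate ω.1 j = true → y ≤ (candidateBound j).val) (i : ℕ) :
    y ≤ (bestBound ω i).val := by
  induction i with
  | zero => exact h _ (Nat.find_spec ω.2)
  | succ i ih =>
    change y ≤ ((cond (checkCandidate ω.1 i) ((candidateBound i).min (bestBound ω i))
      (bestBound ω i)).val : ℚ)
    cases hi : checkCandidate ω.1 i
    · exact ih
    · change y ≤ (((candidateBound i).min (bestBound ω i)).val : ℚ)
      rw [RatCode.val_min, Rat.cast_min]
      exact le_min (h i hi) ih

/-! ### Convergence of the running minima to the pressure -/

section Approximation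

variable {d : ℕ} {X : Subshift (Fin d) ℤ} {φ : C(X.carrier, ℝ)} {ψ : ℕ → List (List ℕ)}
  {χ : ℕ → ℕ × List RatCode}

theorem pressure_le_candidateBound (hX : X.carrier.Nonempty) (hψ : IsLanguageOracle X ψ)
    (hχ : IsPotentialOracle X ψ φ χ) {j : ℕ} (h : checkCandidate (ψ, χ) j = true) :
    pressure X φ ≤ (candidateBound j).val := by
  obtain ⟨g, hg, hgφ⟩ := hχ (candidate j).1
  exact pressure_le_certifiedBound hX hψ hg hgφ (of_decide_eq_true h)

theorem exists_candidateBound_lt (hX : X.carrier.Nonempty) (hψ : IsLanguageOracle X ψ)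
    (hχ : IsPotentialOracle X ψ φ χ) {y : ℝ} (hy : pressure X φ < y) :
    ∃ j, checkCandidate (ψ, χ) j = true ∧ ((candidateBound j).val : ℝ) < y := by
  set C := ⌈‖φ‖⌉₊ + 1 with hC
  have hC' : ‖φ‖ + 1 ≤ C := by
    rw [hC]
    push_cast
    linarith [Nat.le_ceil ‖φ‖]
  have hinv : Tendsto (fun n : ℕ => ((n : ℝ) + 1)⁻¹) atTop (𝓝 0) := by
    simpa only [one_div] using tendsto_one_div_add_atTop_nhds_zero_nat (𝕜 := ℝ)
  have h1 : Tendsto (fun n : ℕ => (1 + ((n : ℝ) + 1)⁻¹) *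
      (pressure X φ + C + (2 * C + 5) * ((n : ℝ) + 1)⁻¹) - C) atTop (𝓝 (pressure X φ)) := by
    have := (((hinv.const_add 1).mul ((hinv.const_mul (2 * (C : ℝ) + 5)).const_add
      (pressure X φ + C))).sub_const (C : ℝ))
    simpa using this
  -- The order of choices matters: `n` fixes `k` and `q` through `χ n`, and only then is `m` taken
  -- large enough to make the boundary term small.
  obtain ⟨n, hn⟩ := (h1.eventually_lt_const hy).exists
  obtain ⟨g, hg, hgφ⟩ := hχ n
  have hodd : Tendsto (fun m : ℕ => 2 * m + 1) atTop atTop :=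
    tendsto_atTop_mono (fun m => show m ≤ 2 * m + 1 by omega) tendsto_id
  have hdiv (b : ℝ) : Tendsto (fun m : ℕ => b / ((2 * m + 1 : ℕ) : ℝ)) atTop (𝓝 0) :=
    (tendsto_const_div_atTop_nhds_zero_nat b).comp hodd
  have h2 := ((((((tendsto_log_partitionFunction φ hX).comp hodd).add_const (C : ℝ)).add_const
    ((2 * (C : ℝ) + 5) * ((n : ℝ) + 1)⁻¹)).add (hdiv (2 * (χ n).1 * entryBound n C (χ n).2 *
      ((n : ℝ) + 1)⁻¹))).const_mul (1 + ((n : ℝ) + 1)⁻¹)).add (hdiv ((n : ℝ) + 1)⁻¹) |>.sub_const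
        (C : ℝ)
  rw [add_zero, add_zero] at h2
  obtain ⟨m, hm⟩ := (h2.eventually_lt_const hn).exists
  obtain ⟨p, hp, hp'⟩ := exists_certificate hX hψ hg hC' hgφ m
  have hj : candidate (Encodable.encode (n, C, m, p)) = (n, C, m, p) :=
    Denumerable.ofNat_encode _
  refine ⟨Encodable.encode (n, C, m, p), ?_, ?_⟩
  · rw [checkCandidate, hj, checkTuple]
    exact decide_eq_true hp
  · rw [candidateBound, hj]
    exact hp'.trans_lt hm

theorem tendsto_bestBound (hX : X.carrier.Nonempty) (ω : CertifiedOracles)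
    (hψ : IsLanguageOracle X ω.1.1) (hχ : IsPotentialOracle X ω.1.1 φ ω.1.2) :
    Tendsto (fun i => ((bestBound ω i).val : ℝ)) atTop (𝓝 (pressure X φ)) := by
  have hanti : Antitone fun i => ((bestBound ω i).val : ℝ) := fun i j hij => by
    have := antitone_bestBound ω hij
    exact Rat.cast_le.2 this
  refine tendsto_atTop_isGLB hanti ⟨?_, ?_⟩
  · rintro _ ⟨i, rfl⟩
    exact le_bestBound (fun j hj => pressure_le_candidateBound hX hψ hχ hj) i
  · refine fun b hb => le_of_forall_gt_imp_ge_of_dense fun y hy => ?_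
    obtain ⟨j, hj, hjy⟩ := exists_candidateBound_lt hX hψ hχ hy
    have h1 : b ≤ ((bestBound ω (j + 1)).val : ℝ) := hb ⟨j + 1, rfl⟩
    have h2 : ((bestBound ω (j + 1)).val : ℝ) ≤ (candidateBound j).val :=
      Rat.cast_le.2 (bestBound_succ_le hj)
    linarith

end Approximation

end SubshiftPressure

theorem mainTheorem8 :
    (∃ M : SubshiftPressure.OracleCode (Fin 2),
      ∀ (d : ℕ) (X : Subshift (Fin d) ℤ), X.carrier.Nonempty →
        ∀ ψ : ℕ → List (List ℕ), SubshiftPressure.IsLanguageOracle X ψ →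
          SubshiftPressure.UpperSemicomputes M X ψ (SubshiftPressure.pressure X)) ∧
    (∀ (d : ℕ) (X : Subshift (Fin d) ℤ), X.carrier.Nonempty → ∀ φ : C(X.carrier, ℝ),
      Tendsto
        (fun n : ℕ => 1 / (n : ℝ) * Real.log (SubshiftPressure.partitionFunction X φ n))
        atTop (𝓝 (SubshiftPressure.pressure X φ)) ∧
      IsGLB {r : ℝ | ∃ n : ℕ, 1 ≤ n ∧
          r = 1 / (n : ℝ) * Real.log (SubshiftPressure.partitionFunction X φ n)}
        (SubshiftPressure.pressure X φ)) := by
  refine ⟨?_, fun d X hX φ => ⟨SubshiftPressure.tendsto_log_partitionFunction φ hX,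
    SubshiftPressure.isGLB_pressure φ hX⟩⟩
  obtain ⟨M, hM⟩ := SubshiftPressure.oracleComputable_bestBound
  refine ⟨M, fun d X hX ψ hψ φ χ hχ => ?_⟩
  -- Any real above the pressure would do; this only provides the certificate that makes the search
  -- halt.
  obtain ⟨j, hj, -⟩ := SubshiftPressure.exists_candidateBound_lt hX hψ hχ
    (lt_add_one (SubshiftPressure.pressure X φ))
  exact ⟨SubshiftPressure.bestBound ⟨(ψ, χ), j, hj⟩, fun n => hM ⟨(ψ, χ), j, hj⟩ n,
    SubshiftPressure.antitone_bestBound _,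
    SubshiftPressure.tendsto_bestBound hX ⟨(ψ, χ), j, hj⟩ hψ hχ⟩
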